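/- Let $p$ be a prime and let $\pi$ be a $p$-special set of primes, i.e. a set of primes such that $q\notin\pi$ for every prime $q$ with $p\mid q(q-1)$. Let $G$ be a finite group that is the mutually permutable product of two subgroups $A$ and $B$; that is, $G=AB$, $A$ permutes with every subgroup of $B$ ($AX=XA$ for all $X\le B$), and $B$ permutes with every subgroup of $A$. Suppose that each of $A$ and $B$ is a normal extension of a $p$-group by a $\pi$-group, i.e. has a normal $p$-subgroup whose quotient is a $\pi$-group (a finite group all of whose order's prime divisors lie in $\pi$). Then $G$ is also a normal extension of a $p$-group by a $\pi$-group: $G$ has a normal $p$-subgroup $N$ such that $G/N$ is a $\pi$-group. -/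

import Mathlib

open scoped Pointwise

/-- `π` is a `p`-special set of primes: `q ∉ π` whenever `q` is a prime with `p ∣ q (q - 1)`. -/
def IsPSpecial (p : ℕ) (π : Set ℕ) : Prop :=
  (∀ q ∈ π, q.Prime) ∧ ∀ q : ℕ, q.Prime → p ∣ q * (q - 1) → q ∉ π

/-- The finite group `G` is a `π`-group: every prime divisor of its order lies in `π`. -/
def IsPiGroup (π : Set ℕ) (G : Type*) [Group G] : Prop :=
  ∀ q : ℕ, q.Prime → q ∣ Nat.card G → q ∈ π

/-- The finite group `G` is a normal extension of a `p`-group by a `π`-group: it has a normal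
`p`-subgroup with quotient a `π`-group. -/
def IsExtensionPGroupByPiGroup (p : ℕ) (π : Set ℕ) (G : Type*) [Group G] : Prop :=
  ∃ (N : Subgroup G) (_ : N.Normal), IsPGroup p N ∧ IsPiGroup π (G ⧸ N)

/-- Two subgroups permute: `H K = K H` as subsets of `G`. -/
def Subgroup.Permutes {G : Type*} [Group G] (H K : Subgroup G) : Prop :=
  (H : Set G) * (K : Set G) = (K : Set G) * (H : Set G)

/-- `G = A B` is the mutually permutable product of its subgroups `A` and `B`: `A` permutes with
every subgroup of `B`, and `B` permutes with every subgroup of `A`. -/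
structure IsMutuallyPermutableProduct {G : Type*} [Group G] (A B : Subgroup G) : Prop where
  mul_eq_univ : (A : Set G) * (B : Set G) = Set.univ
  left_permutes : ∀ X : Subgroup G, X ≤ B → A.Permutes X
  right_permutes : ∀ X : Subgroup G, X ≤ A → B.Permutes X

/-! Since `p` is not in `π`, being an extension of a `p`-group by a `π`-group amounts to being
`p`-closed with all prime divisors of the order in `π ∪ {p}`. The orders of `A` and `B` control that
of `G`, so the task is to show `G` `p`-closed, knowing that no prime divisor of `|G|` is 1 mod `p`.

Induct on `|G|`. Put `D = A ∩ B`, and let `O(B)` be the group of `p`-elements of `B`. Subgroups of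
`A` and `B` containing `D` still mutually permute, so their product is `p`-closed when proper.

If `D O(B) ≠ B`, then `A D O(B)` is proper and holds a Sylow subgroup `P` of `G` as its core. Were
`P` not normal, its normalizer would have prime index `r`, and Sylow's theorem would give `r ≡ 1`
mod `p` (`isPClosed_top_of_core_sup_ne`). The case `D O(A) ≠ A` is symmetric.

Otherwise, unless one factor contains the other, `A` and `B` lie in `p`-closed subgroups of index
`p` (`exists_isPClosed_index_eq`), whose normal `p`-subgroups generate a normal Sylow subgroup of
`G` (`IsPClosed.top_of_index_eq`). -/

namespace Subgroup

/-! ### Permuting subgroups. -/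

variable {G : Type*} [Group G] {H K L : Subgroup G}

theorem Permutes.symm (h : H.Permutes K) : K.Permutes H := Eq.symm h

theorem Permutes.exists_mul_eq (h : H.Permutes K) {x y : G} (hx : x ∈ H) (hy : y ∈ K) :
    ∃ y' ∈ K, ∃ x' ∈ H, y' * x' = x * y := by
  have : x * y ∈ (K : Set G) * (H : Set G) := h ▸ Set.mul_mem_mul hx hy
  obtain ⟨y', hy', x', hx', e⟩ := this
  exact ⟨y', hy', x', hx', e⟩

theorem permutes_of_exists (h : ∀ x ∈ H, ∀ y ∈ K, ∃ y' ∈ K, ∃ x' ∈ H, y' * x' = x * y) :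
    H.Permutes K := by
  ext g
  constructor
  · rintro ⟨x, hx, y, hy, rfl⟩
    obtain ⟨y', hy', x', hx', e⟩ := h x hx y hy
    exact ⟨y', hy', x', hx', e⟩
  · rintro ⟨y, hy, x, hx, rfl⟩
    obtain ⟨y', hy', x', hx', e⟩ := h x⁻¹ (H.inv_mem hx) y⁻¹ (K.inv_mem hy)
    refine ⟨x'⁻¹, H.inv_mem hx', y'⁻¹, K.inv_mem hy', ?_⟩
    have := congrArg (·⁻¹) e
    simpa using this

theorem permutes_of_le_normalizer (h : H ≤ normalizer (K : Set G)) : H.Permutes K :=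
  permutes_of_exists fun x hx y hy ↦
    ⟨x * y * x⁻¹, (mem_normalizer_iff.1 (h hx) y).1 hy, x, hx, by group⟩

theorem Permutes.mem_sup_iff (h : H.Permutes K) {g : G} :
    g ∈ H ⊔ K ↔ ∃ x ∈ H, ∃ y ∈ K, x * y = g := by
  constructor
  · intro hg
    rw [← H.closure_eq, ← K.closure_eq, ← closure_union] at hg
    induction hg using closure_induction with
    | mem z hz =>
      rcases hz with hz | hz
      · exact ⟨z, hz, 1, K.one_mem, mul_one z⟩
      · exact ⟨1, H.one_mem, z, hz, one_mul z⟩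
    | inv a _ ih =>
      obtain ⟨x, hx, y, hy, rfl⟩ := ih
      obtain ⟨x₂, hx₂, y₂, hy₂, e⟩ := h.symm.exists_mul_eq (K.inv_mem hy) (H.inv_mem hx)
      exact ⟨x₂, hx₂, y₂, hy₂, by rw [e]; group⟩
    | one => exact ⟨1, H.one_mem, 1, K.one_mem, mul_one 1⟩
    | mul a b _ _ iha ihb =>
      obtain ⟨x, hx, y, hy, rfl⟩ := iha
      obtain ⟨x₁, hx₁, y₁, hy₁, rfl⟩ := ihb
      obtain ⟨x₂, hx₂, y₂, hy₂, e⟩ := h.symm.exists_mul_eq hy hx₁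
      refine ⟨x * x₂, H.mul_mem hx hx₂, y₂ * y₁, K.mul_mem hy₂ hy₁, ?_⟩
      calc x * x₂ * (y₂ * y₁) = x * (x₂ * y₂) * y₁ := by group
        _ = x * y * (x₁ * y₁) := by rw [e]; group
  · rintro ⟨x, hx, y, hy, rfl⟩
    exact mul_mem (mem_sup_left hx) (mem_sup_right hy)

/-- `K` acts transitively on `G ⧸ H`, and the stabilizer of the base coset is `H ⊓ K`. -/
theorem index_eq_relIndex_of_mul (h : ∀ g : G, ∃ k ∈ K, ∃ x ∈ H, k * x = g) :
    H.index = H.relIndex K := by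
  have : MulAction.IsPretransitive K (G ⧸ H) := by
    rw [MulAction.isPretransitive_iff_base ((1 : G) : G ⧸ H)]
    intro q
    induction q using QuotientGroup.induction_on with
    | H g =>
      obtain ⟨k, hk, x, hx, rfl⟩ := h g
      refine ⟨⟨k, hk⟩, ?_⟩
      change ((k * 1 : G) : G ⧸ H) = _
      rw [QuotientGroup.eq]
      simpa using hx
  have h2 := MulAction.index_stabilizer_of_transitive (G := K) ((1 : G) : G ⧸ H)
  have h3 : MulAction.stabilizer K ((1 : G) : G ⧸ H) = H.subgroupOf K := by
    ext k
    rw [MulAction.mem_stabilizer_iff, mem_subgroupOf]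
    change (((k : G) * 1 : G) : G ⧸ H) = _ ↔ _
    rw [QuotientGroup.eq]
    simp
  rw [index_eq_card, ← h2, h3, relIndex]

theorem Permutes.relIndex_sup_right (h : H.Permutes K) :
    H.relIndex (H ⊔ K) = H.relIndex K := by
  rw [← relIndex_subgroupOf (le_sup_right : K ≤ H ⊔ K), relIndex]
  refine index_eq_relIndex_of_mul fun g ↦ ?_
  obtain ⟨k, hk, x, hx, e⟩ := h.symm.mem_sup_iff.1 (sup_comm H K ▸ g.2 : (g : G) ∈ K ⊔ H)
  exact ⟨⟨k, mem_sup_right hk⟩, hk, ⟨x, mem_sup_left hx⟩, hx, Subtype.ext e⟩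

/-- A form of Dedekind's law. -/
theorem Permutes.sup_inf_eq (h : H.Permutes K) (hK : K ≤ L) (hHL : H ⊓ L ≤ K) :
    (H ⊔ K) ⊓ L = K := by
  refine le_antisymm ?_ (le_inf le_sup_right hK)
  rintro g ⟨hg, hgL⟩
  obtain ⟨x, hx, y, hy, rfl⟩ := h.mem_sup_iff.1 hg
  exact K.mul_mem (hHL ⟨hx, (L.mul_mem_cancel_right (hK hy)).1 hgL⟩) hy

end Subgroup

/-! ### Mutually permuting pairs. -/

section MutuallyPermutable

variable {G : Type*} [Group G] {A B : Subgroup G}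

/-- `A` permutes with every subgroup of `B`, and `B` permutes with every subgroup of `A`. -/
structure MutuallyPermute (A B : Subgroup G) : Prop where
  left_permutes : ∀ X : Subgroup G, X ≤ B → A.Permutes X
  right_permutes : ∀ X : Subgroup G, X ≤ A → B.Permutes X

namespace MutuallyPermute

open Subgroup

theorem symm (h : MutuallyPermute A B) : MutuallyPermute B A :=
  ⟨h.right_permutes, h.left_permutes⟩

theorem inf_permutes (h : MutuallyPermute A B) {X : Subgroup G} (hX : X ≤ B) :
    (A ⊓ B).Permutes X := by
  refine permutes_of_exists ?_
  rintro d ⟨hdA, hdB⟩ x hx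
  obtain ⟨x', hx', a, ha, e⟩ := (h.left_permutes X hX).exists_mul_eq hdA hx
  refine ⟨x', hx', a, ⟨ha, ?_⟩, e⟩
  refine (B.mul_mem_cancel_left (hX hx')).1 ?_
  rw [e]
  exact B.mul_mem hdB (hX hx)

theorem permutes_of_inf_le_left (h : MutuallyPermute A B) {X Y : Subgroup G} (hX : X ≤ A)
    (hY : Y ≤ B) (hD : A ⊓ B ≤ X) : X.Permutes Y := by
  refine permutes_of_exists fun x hx y hy ↦ ?_
  obtain ⟨y', hy', a, ha, e⟩ := (h.left_permutes Y hY).exists_mul_eq (hX hx) hy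
  refine ⟨y', hy', a, ?_, e⟩
  -- By Dedekind's law `BX ∩ A = X`, because `A ∩ B ≤ X`; this forces `a` into `X`.
  have ha' : a ∈ B ⊔ X := by
    have : a = y'⁻¹ * (x * y) := by rw [← e]; group
    rw [this]
    exact mul_mem (mem_sup_left (B.inv_mem (hY hy')))
      (mul_mem (mem_sup_right hx) (mem_sup_left (hY hy)))
  have := (h.right_permutes X hX).sup_inf_eq hX (inf_comm A B ▸ hD)
  rw [← this]
  exact ⟨ha', ha⟩

/-- Makes the induction possible: the hypothesis passes to subgroups of the factors above `A ⊓ B`.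
-/
theorem mono (h : MutuallyPermute A B) {A' B' : Subgroup G} (hA : A' ≤ A) (hB : B' ≤ B)
    (hDA : A ⊓ B ≤ A') (hDB : A ⊓ B ≤ B') : MutuallyPermute A' B' :=
  ⟨fun _ hX ↦ h.permutes_of_inf_le_left hA (hX.trans hB) hDA,
    fun _ hX ↦ h.symm.permutes_of_inf_le_left hB (hX.trans hA) (inf_comm A B ▸ hDB)⟩

theorem subgroupOf (h : MutuallyPermute A B) {H : Subgroup G} (hA : A ≤ H) (hB : B ≤ H) :
    MutuallyPermute (A.subgroupOf H) (B.subgroupOf H) := by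
  have key : ∀ {A B : Subgroup G}, A ≤ H → B ≤ H →
      (∀ X : Subgroup G, X ≤ B → A.Permutes X) → ∀ X : Subgroup H, X ≤ B.subgroupOf H →
      (A.subgroupOf H).Permutes X := by
    intro A B hA hB hAB X hX
    refine permutes_of_exists fun a ha x hx ↦ ?_
    have hXB : X.map H.subtype ≤ B := by
      rintro _ ⟨z, hz, rfl⟩
      exact hX hz
    obtain ⟨_, ⟨z, hz, rfl⟩, a', ha', e⟩ := (hAB _ hXB).exists_mul_eq
      (mem_subgroupOf.1 ha) (mem_map_of_mem H.subtype hx)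
    exact ⟨z, hz, ⟨a', hA ha'⟩, ha', Subtype.ext e⟩
  exact ⟨key hA hB h.left_permutes, key hB hA h.right_permutes⟩

theorem sup_inf_eq (h : MutuallyPermute A B) {T : Subgroup G} (hT : T ≤ B) (hD : A ⊓ B ≤ T) :
    (A ⊔ T) ⊓ B = T :=
  (h.left_permutes T hT).sup_inf_eq hT hD

theorem index_sup (h : MutuallyPermute A B) (hG : A ⊔ B = ⊤) {T : Subgroup G} (hT : T ≤ B)
    (hD : A ⊓ B ≤ T) : (A ⊔ T).index = T.relIndex B := by
  rw [← congrArg (fun S ↦ S.relIndex B) (h.sup_inf_eq hT hD), inf_relIndex_right]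
  refine index_eq_relIndex_of_mul fun g ↦ ?_
  have hg : g ∈ B ⊔ A := by rw [sup_comm, hG]; trivial
  obtain ⟨b, hb, a, ha, e⟩ := (h.right_permutes A le_rfl).mem_sup_iff.1 hg
  exact ⟨b, hb, a, mem_sup_left ha, e⟩

theorem sup_ne_top (h : MutuallyPermute A B) {T : Subgroup G} (hT : T ≤ B)
    (hD : A ⊓ B ≤ T) (hne : T ≠ B) : A ⊔ T ≠ ⊤ := by
  intro htop
  have := h.sup_inf_eq hT hD
  rw [htop, top_inf_eq] at this
  exact hne this.symm

end MutuallyPermute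

end MutuallyPermutable

/-! ### `p`-closed subgroups and their cores. -/

/-- The order of `x` is a power of `p`. -/
def IsPElement {G : Type*} [Group G] (p : ℕ) (x : G) : Prop :=
  ∃ k : ℕ, x ^ p ^ k = 1

/-- The `p`-elements of `H` are closed under multiplication, so that they form a normal Sylow
`p`-subgroup of `H`. -/
def IsPClosed {G : Type*} [Group G] (p : ℕ) (H : Subgroup G) : Prop :=
  ∀ x ∈ H, ∀ y ∈ H, IsPElement p x → IsPElement p y → IsPElement p (x * y)

section PClosed

open Subgroup

variable {G : Type*} [Group G] {p : ℕ} {H K Q : Subgroup G}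

theorem IsPElement.of_mem (hQ : IsPGroup p Q) {x : G} (hx : x ∈ Q) : IsPElement p x := by
  obtain ⟨k, hk⟩ := hQ ⟨x, hx⟩
  exact ⟨k, congrArg Subtype.val hk⟩

theorem IsPElement.map {G' : Type*} [Group G'] (f : G →* G') {x : G} (hx : IsPElement p x) :
    IsPElement p (f x) := by
  obtain ⟨k, hk⟩ := hx
  exact ⟨k, by rw [← map_pow, hk, map_one]⟩

theorem isPElement_coe {x : H} : IsPElement p (x : G) ↔ IsPElement p x :=
  ⟨fun ⟨k, hk⟩ ↦ ⟨k, Subtype.ext hk⟩, fun h ↦ h.map H.subtype⟩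

theorem IsPElement.isPGroup_zpowers {x : G} (hx : IsPElement p x) :
    IsPGroup p (zpowers x) := by
  obtain ⟨k, hk⟩ := hx
  rintro ⟨_, n, rfl⟩
  refine ⟨k, Subtype.ext ?_⟩
  change (x ^ n) ^ p ^ k = 1
  rw [← zpow_natCast, zpow_comm, zpow_natCast, hk, one_zpow]

theorem IsPClosed.mono (hK : IsPClosed p K) (h : H ≤ K) : IsPClosed p H :=
  fun x hx y hy ↦ hK x (h hx) y (h hy)

theorem isPClosed_top_iff : IsPClosed p (⊤ : Subgroup H) ↔ IsPClosed p H := by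
  constructor
  · intro h x hx y hy hpx hpy
    exact isPElement_coe.2
      (h ⟨x, hx⟩ trivial ⟨y, hy⟩ trivial (isPElement_coe.1 hpx) (isPElement_coe.1 hpy))
  · intro h x _ y _ hpx hpy
    exact isPElement_coe.1 (h x x.2 y y.2 (isPElement_coe.2 hpx) (isPElement_coe.2 hpy))

theorem IsPClosed.subgroupOf (hH : IsPClosed p H) (K : Subgroup G) :
    IsPClosed p (H.subgroupOf K) :=
  fun x hx y hy hpx hpy ↦
    isPElement_coe.1 (hH x hx y hy (isPElement_coe.2 hpx) (isPElement_coe.2 hpy))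

/-- The subgroup of all `p`-elements of a `p`-closed subgroup. -/
def IsPClosed.core (hH : IsPClosed p H) : Subgroup G where
  carrier := {x | x ∈ H ∧ IsPElement p x}
  one_mem' := ⟨H.one_mem, 0, one_pow _⟩
  mul_mem' := fun ha hb ↦ ⟨H.mul_mem ha.1 hb.1, hH _ ha.1 _ hb.1 ha.2 hb.2⟩
  inv_mem' := fun ⟨hx, k, hk⟩ ↦ ⟨H.inv_mem hx, k, by rw [inv_pow, hk, inv_one]⟩

namespace IsPClosed

theorem core_le (hH : IsPClosed p H) : hH.core ≤ H := fun _ hx ↦ hx.1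

theorem isPGroup_core (hH : IsPClosed p H) : IsPGroup p hH.core := by
  rintro ⟨x, _, k, hk⟩
  exact ⟨k, Subtype.ext hk⟩

theorem core_mono (hH : IsPClosed p H) (hK : IsPClosed p K) (h : H ≤ K) : hH.core ≤ hK.core :=
  fun _ hx ↦ ⟨h hx.1, hx.2⟩

theorem conj_mem_core (hH : IsPClosed p H) {g x : G} (hg : ∀ y ∈ H, g * y * g⁻¹ ∈ H)
    (hx : x ∈ hH.core) : g * x * g⁻¹ ∈ hH.core :=
  ⟨hg x hx.1, by simpa [MulAut.conj_apply] using hx.2.map (MulAut.conj g).toMonoidHom⟩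

theorem core_normal (hH : IsPClosed p H) [hn : H.Normal] : hH.core.Normal :=
  ⟨fun _ hx g ↦ hH.conj_mem_core (fun y hy ↦ hn.conj_mem y hy g) hx⟩

theorem le_normalizer_core (hH : IsPClosed p H) : H ≤ normalizer (hH.core : Set G) := by
  have key : ∀ g ∈ H, ∀ x ∈ hH.core, g * x * g⁻¹ ∈ hH.core := fun g hg x ↦
    hH.conj_mem_core fun y hy ↦ mul_mem (mul_mem hg hy) (inv_mem hg)
  refine fun g hg ↦ mem_normalizer_iff.2 fun x ↦ ⟨key g hg x, fun hx ↦ ?_⟩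
  have := key g⁻¹ (inv_mem hg) _ hx
  simpa [mul_assoc] using this

theorem not_dvd_relIndex_core [Finite G] [hp : Fact p.Prime] (hH : IsPClosed p H) :
    ¬ p ∣ hH.core.relIndex H := by
  obtain ⟨P⟩ : Nonempty (Sylow p H) := inferInstance
  have hP : (P : Subgroup H) ≤ hH.core.subgroupOf H := fun x hx ↦
    ⟨x.2, isPElement_coe.2 (.of_mem P.2 hx)⟩
  exact fun h ↦ P.not_dvd_index (h.trans (index_dvd_of_le hP))

theorem factorization_card_core [Finite G] [hp : Fact p.Prime] (hH : IsPClosed p H) :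
    (Nat.card hH.core).factorization p = (Nat.card H).factorization p := by
  have h := relIndex_mul_relIndex ⊥ hH.core H bot_le hH.core_le
  rw [relIndex_bot_left, relIndex_bot_left] at h
  have h0 : hH.core.relIndex H ≠ 0 := index_ne_zero_of_finite
  rw [← h, Nat.factorization_mul Nat.card_pos.ne' h0, Finsupp.add_apply,
    Nat.factorization_eq_zero_of_not_dvd hH.not_dvd_relIndex_core, add_zero]

theorem of_normal_of_not_dvd_index [Finite G] [hp : Fact p.Prime] {P : Subgroup G}
    [hn : P.Normal] (hP : IsPGroup p P) (hi : ¬ p ∣ P.index) :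
    IsPClosed p (⊤ : Subgroup G) := by
  have key : ∀ x : G, IsPElement p x → x ∈ P := fun x hx ↦ by
    have h := hx.isPGroup_zpowers.to_sup_of_normal_right hP
    have := (hP.toSylow hi).is_maximal' h le_sup_right
    exact this.le (mem_sup_left (mem_zpowers x))
  exact fun x _ y _ hx hy ↦ .of_mem hP (P.mul_mem (key x hx) (key y hy))

/-- A `p`-closed subgroup of index `p` contains a normal `p`-subgroup of the whole group which
has index at most `p` in a Sylow `p`-subgroup. -/
theorem exists_normal_of_index_eq [Finite G] [hp : Fact p.Prime] (hH : IsPClosed p H)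
    (hi : H.index = p) : ∃ N : Subgroup G, N.Normal ∧ N ≤ H ∧ IsPGroup p N ∧
      (Nat.card G).factorization p ≤ (Nat.card N).factorization p + 1 := by
  have hC : IsPClosed p H.normalCore := hH.mono H.normalCore_le
  refine ⟨hC.core, hC.core_normal, hC.core_le.trans H.normalCore_le, hC.isPGroup_core, ?_⟩
  -- The quotient by the normal core embeds in the symmetric group on the `p` cosets of `H`, and `p
  -- ^ 2` does not divide `p!`.
  have hdvd : H.normalCore.index ∣ p.factorial := by
    rw [normalCore_eq_ker, index_ker]
    refine (card_subgroup_dvd_card _).trans ?_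
    rw [Nat.card_perm, ← index_eq_card, hi]
  have hfac : (p.factorial).factorization p ≤ 1 := by
    rw [← Nat.mul_factorial_pred hp.out.ne_zero,
      Nat.factorization_mul hp.out.ne_zero (Nat.factorial_ne_zero _), Finsupp.add_apply,
      hp.out.factorization_self, Nat.factorization_eq_zero_of_not_dvd]
    rw [hp.out.dvd_factorial]
    have := hp.out.pos
    omega
  rw [hC.factorization_card_core, ← H.normalCore.card_mul_index,
    Nat.factorization_mul Nat.card_pos.ne' index_ne_zero_of_finite, Finsupp.add_apply]
  have := (Nat.factorization_le_iff_dvd index_ne_zero_of_finite p.factorial_ne_zero).2 hdvd p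
  omega

end IsPClosed

end PClosed

/-! ### The inductive step. -/

section Step

open Subgroup

variable {G : Type*} [Group G]

theorem Subgroup.exists_prime_pow_mem [Finite G] {N : Subgroup G} {x : G} (hx : x ∉ N) :
    ∃ k r : ℕ, r.Prime ∧ x ^ k ∉ N ∧ (x ^ k) ^ r ∈ N := by
  have key : ∀ n : ℕ, 0 < n → x ^ n ∈ N → ∃ k r : ℕ, r.Prime ∧ x ^ k ∉ N ∧ (x ^ k) ^ r ∈ N := by
    intro n
    induction n using Nat.strong_induction_on with
    | _ n ih =>
      intro hn hxn
      have hn1 : n ≠ 1 := by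
        rintro rfl
        exact hx (pow_one x ▸ hxn)
      have hr := Nat.minFac_prime hn1
      have hdiv : n / n.minFac * n.minFac = n := Nat.div_mul_cancel n.minFac_dvd
      by_cases h : x ^ (n / n.minFac) ∈ N
      · exact ih _ (Nat.div_lt_self hn hr.one_lt)
          (Nat.div_pos (Nat.minFac_le hn) hr.pos) h
      · exact ⟨_, _, hr, h, by rwa [← pow_mul, hdiv]⟩
  exact key (orderOf x) (orderOf_pos x) (by rw [pow_orderOf_eq_one]; exact N.one_mem)

theorem Subgroup.relIndex_zpowers_dvd [Finite G] {N : Subgroup G} {b : G} {r : ℕ}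
    (h : b ^ r ∈ N) : N.relIndex (zpowers b) ∣ r := by
  refine (relIndex_dvd_of_le_left _ ((zpowers_le (H := N)).2 h)).trans ?_
  have h1 := relIndex_mul_relIndex ⊥ (zpowers (b ^ r)) (zpowers b) bot_le
    (zpowers_le.2 (pow_mem (mem_zpowers b) r))
  rw [relIndex_bot_left, relIndex_bot_left, Nat.card_zpowers, Nat.card_zpowers, orderOf_pow] at h1
  have h2 := Nat.div_mul_cancel (Nat.gcd_dvd_left (orderOf b) r)
  have h3 : 0 < orderOf b / (orderOf b).gcd r :=
    Nat.div_pos (Nat.gcd_le_left _ (orderOf_pos b)) (Nat.gcd_pos_of_pos_left _ (orderOf_pos b))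
  rw [Nat.eq_of_mul_eq_mul_left h3 (h1.trans h2.symm)]
  exact Nat.gcd_dvd_right _ _

variable {p : ℕ} {A B : Subgroup G}

namespace MutuallyPermute

variable [Finite G] [hp : Fact p.Prime]

theorem isPClosed_top_of_core_sup_ne (h : MutuallyPermute A B) (hG : A ⊔ B = ⊤)
    (hB : IsPClosed p B) (hr : ∀ r : ℕ, r.Prime → r ∣ Nat.card G → ¬ r ≡ 1 [MOD p])
    (ih : ∀ T ≤ B, A ⊓ B ≤ T → T ≠ B → IsPClosed p (A ⊔ T))
    (hne : (A ⊓ B) ⊔ hB.core ≠ B) : IsPClosed p (⊤ : Subgroup G) := by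
  have hTB : (A ⊓ B) ⊔ hB.core ≤ B := sup_le inf_le_right hB.core_le
  have hK := ih _ hTB le_sup_left hne
  have hKi : ¬ p ∣ (A ⊔ ((A ⊓ B) ⊔ hB.core)).index := by
    rw [h.index_sup hG hTB le_sup_left]
    exact fun hd ↦ hB.not_dvd_relIndex_core
      (hd.trans (relIndex_dvd_of_le_left _ le_sup_right))
  have hPi : ¬ p ∣ hK.core.index := by
    rw [← relIndex_mul_index hK.core_le, hp.out.dvd_mul]
    exact not_or_intro hK.not_dvd_relIndex_core hKi
  let P : Sylow p G := hK.isPGroup_core.toSylow hPi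
  have hKN : A ⊔ ((A ⊓ B) ⊔ hB.core) ≤ normalizer (hK.core : Set G) := hK.le_normalizer_core
  by_cases hBN : B ≤ normalizer (hK.core : Set G)
  · have : hK.core.Normal := by
      rw [← normalizer_eq_top_iff, eq_top_iff, ← hG]
      exact sup_le (le_sup_left.trans hKN) hBN
    exact .of_normal_of_not_dvd_index hK.isPGroup_core hPi
  exfalso
  obtain ⟨b₀, hb₀, hb₀N⟩ := SetLike.not_le_iff_exists.1 hBN
  obtain ⟨k, r, hrp, hbN, hbr⟩ := exists_prime_pow_mem hb₀N
  set b := b₀ ^ k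
  have hbB : zpowers b ≤ B := zpowers_le.2 (pow_mem hb₀ k)
  have hDb := h.inf_permutes hbB
  -- If `T ≠ B`, then `AT` is `p`-closed with core `P`, so `b` normalizes `P`. If `T = B`, then `G`
  -- is the product of `⟨b⟩` and the normalizer of `P`, whose index therefore divides `r`.
  set T := hB.core ⊔ ((A ⊓ B) ⊔ zpowers b) with hT
  have hTle : T ≤ B := sup_le hB.core_le (sup_le inf_le_right hbB)
  have hDT : A ⊓ B ≤ T := le_sup_left.trans le_sup_right
  have hbT : b ∈ T := mem_sup_right (mem_sup_right (mem_zpowers b))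
  by_cases hTe : T = B
  · have hidx : (normalizer (hK.core : Set G)).index ∣ r := by
      refine Eq.dvd ?_ |>.trans (relIndex_zpowers_dvd hbr)
      refine index_eq_relIndex_of_mul fun g ↦ ?_
      have hg : g⁻¹ ∈ A ⊔ B := hG ▸ mem_top _
      obtain ⟨a, ha, y, hy, e⟩ := (h.left_permutes B le_rfl).mem_sup_iff.1 hg
      rw [← hTe, hT] at hy
      have hperm : ((A ⊓ B) ⊔ zpowers b).Permutes hB.core :=
        permutes_of_le_normalizer ((sup_le inf_le_right hbB).trans hB.le_normalizer_core)
      obtain ⟨c, hc, z, hz, e₁⟩ := hperm.symm.mem_sup_iff.1 hy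
      obtain ⟨d, hd, w, hw, e₂⟩ := hDb.mem_sup_iff.1 hz
      refine ⟨w⁻¹, inv_mem hw, (a * c * d)⁻¹, inv_mem (hKN ?_), ?_⟩
      · exact mul_mem (mul_mem (mem_sup_left ha) (mem_sup_right (mem_sup_right hc)))
          (mem_sup_left hd.1)
      · rw [← inv_inj, ← e, ← e₁, ← e₂]
        group
    rcases (Nat.dvd_prime hrp).1 hidx with h1 | h1
    · rw [index_eq_one] at h1
      exact hbN (h1 ▸ mem_top b)
    -- Here `r` is the number of Sylow `p`-subgroups.
    · have h2 := P.card_eq_index_normalizer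
      have h3 := card_sylow_modEq_one p G
      have h4 : (normalizer ((P : Subgroup G) : Set G)).index = r := h1
      rw [h2.trans h4] at h3
      exact hr r hrp (h1 ▸ index_dvd_card _) h3
  · have hAT := ih T hTle hDT hTe
    have hle : A ⊔ ((A ⊓ B) ⊔ hB.core) ≤ A ⊔ T :=
      sup_le_sup_left (sup_le hDT le_sup_left) A
    have heq : hAT.core = hK.core := P.is_maximal' hAT.isPGroup_core (hK.core_mono hAT hle)
    apply hbN
    rw [← heq]
    exact hAT.le_normalizer_core (mem_sup_right hbT)

theorem exists_isPClosed_index_eq (h : MutuallyPermute A B) (hG : A ⊔ B = ⊤)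
    (hB : IsPClosed p B) (ih : ∀ T ≤ B, A ⊓ B ≤ T → T ≠ B → IsPClosed p (A ⊔ T))
    (he : (A ⊓ B) ⊔ hB.core = B) (hBA : ¬ B ≤ A) :
    ∃ L : Subgroup G, A ≤ L ∧ L.index = p ∧ IsPClosed p L := by
  have hQ : (A ⊓ B).subgroupOf hB.core ≠ ⊤ := by
    rw [Ne, subgroupOf_eq_top]
    intro hle
    rw [sup_eq_left.2 hle] at he
    exact hBA (inf_eq_right.1 he)
  obtain ⟨n, hn⟩ := IsPGroup.iff_card.1 hB.isPGroup_core
  obtain ⟨m, hm⟩ := IsPGroup.iff_card.1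
    (hB.isPGroup_core.to_subgroup ((A ⊓ B).subgroupOf hB.core))
  have hmn : m < n := by
    have : Nat.card ((A ⊓ B).subgroupOf hB.core) < Nat.card hB.core :=
      lt_of_le_of_ne (card_le_card_group _) fun hc ↦ hQ (eq_top_of_card_eq _ hc)
    rw [hm, hn] at this
    exact (Nat.pow_lt_pow_iff_right hp.out.one_lt).1 this
  -- A subgroup of index `p` in the core of `B` containing its intersection with `A ⊓ B`; joining it
  -- to `A ⊓ B` keeps the index `p` in `B`.
  obtain ⟨K, hKc, hQK⟩ := Sylow.exists_subgroup_card_pow_prime_le p (m := n - 1)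
    (hn ▸ pow_dvd_pow p (Nat.sub_le n 1)) _ hm (by omega)
  have hKi : K.index = p := by
    have := K.card_mul_index
    rw [hKc, hn, ← Nat.sub_add_cancel (Nat.one_le_of_lt hmn), pow_succ] at this
    exact Nat.eq_of_mul_eq_mul_left (pow_pos hp.out.pos _) this
  set Y := K.map hB.core.subtype with hY
  have hYP : Y ≤ hB.core := map_subtype_le K
  have hYi : Y.relIndex hB.core = p := by
    rw [relIndex, hY, Subgroup.subgroupOf, comap_map_eq_self_of_injective hB.core.subtype_injective, hKi]
  have hDY : (A ⊓ B) ⊓ hB.core ≤ Y := fun x hx ↦ ⟨⟨x, hx.2⟩, hQK hx.1, rfl⟩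
  have hM : (A ⊓ B) ⊔ Y ≤ B := sup_le inf_le_right (hYP.trans hB.core_le)
  have hMi : ((A ⊓ B) ⊔ Y).relIndex B = p := by
    have hperm : ((A ⊓ B) ⊔ Y).Permutes hB.core :=
      permutes_of_le_normalizer (hM.trans hB.le_normalizer_core)
    have := hperm.relIndex_sup_right
    rw [sup_assoc, sup_eq_right.2 hYP, he] at this
    rw [this, ← inf_relIndex_right,
      (h.inf_permutes (hYP.trans hB.core_le)).sup_inf_eq hYP hDY, hYi]
  refine ⟨A ⊔ ((A ⊓ B) ⊔ Y), le_sup_left, ?_, ih _ hM le_sup_left ?_⟩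
  · rw [h.index_sup hG hM le_sup_left, hMi]
  · intro hc
    rw [hc, relIndex_self] at hMi
    exact hp.out.one_lt.ne hMi

end MutuallyPermute

theorem IsPClosed.top_of_index_eq [Finite G] [hp : Fact p.Prime] {L₁ L₂ : Subgroup G}
    (h₁ : IsPClosed p L₁) (h₂ : IsPClosed p L₂) (hi₁ : L₁.index = p) (hi₂ : L₂.index = p)
    (hmul : ∀ g : G, ∃ y ∈ L₂, ∃ x ∈ L₁, y * x = g) : IsPClosed p (⊤ : Subgroup G) := by
  obtain ⟨N₁, hN₁, hle₁, hp₁, hc₁⟩ := h₁.exists_normal_of_index_eq hi₁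
  obtain ⟨N₂, hN₂, hle₂, hp₂, hc₂⟩ := h₂.exists_normal_of_index_eq hi₂
  have hinf : (L₁ ⊓ L₂).index = p * p := by
    rw [← relIndex_mul_index (inf_le_right : L₁ ⊓ L₂ ≤ L₂), inf_relIndex_right,
      ← index_eq_relIndex_of_mul hmul, hi₁, hi₂]
  have hv : (Nat.card G).factorization p =
      (Nat.card (L₁ ⊓ L₂ : Subgroup G)).factorization p + 2 := by
    rw [← (L₁ ⊓ L₂).card_mul_index, hinf,
      Nat.factorization_mul Nat.card_pos.ne' (mul_ne_zero hp.out.ne_zero hp.out.ne_zero),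
      Nat.factorization_mul hp.out.ne_zero hp.out.ne_zero]
    simp [hp.out.factorization_self]
  -- `L₁ ⊓ L₂` lacks two factors `p` of `|G|`, whereas `N₁` lacks at most one.
  have hnle : ¬ N₁ ≤ L₂ := fun hle ↦ by
    have := (Nat.factorization_le_iff_dvd Nat.card_pos.ne' Nat.card_pos.ne').2
      (card_dvd_of_le (le_inf hle₁ hle)) p
    omega
  have hN : IsPGroup p (N₁ ⊔ N₂ : Subgroup G) := hp₁.to_sup_of_normal_right hp₂
  have hlt : N₂ < N₁ ⊔ N₂ :=
    lt_of_le_of_ne le_sup_right fun he ↦ hnle (le_sup_left.trans (he ▸ hle₂))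
  -- `N₂` lacks at most one factor `p`, so the strictly larger `p`-group `N₁ ⊔ N₂` lacks none.
  refine .of_normal_of_not_dvd_index hN fun hd ↦ ?_
  obtain ⟨a, ha⟩ := IsPGroup.iff_card.1 hp₂
  obtain ⟨b, hb⟩ := IsPGroup.iff_card.1 hN
  have hab : a < b := by
    have := Set.ncard_lt_ncard (SetLike.coe_ssubset_coe.2 hlt) (Set.toFinite _)
    rw [← Nat.card_coe_set_eq, ← Nat.card_coe_set_eq] at this
    change Nat.card N₂ < Nat.card (N₁ ⊔ N₂ : Subgroup G) at this
    rw [ha, hb] at this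
    exact (Nat.pow_lt_pow_iff_right hp.out.one_lt).1 this
  have hi := hp.out.factorization_pos_of_dvd (index_ne_zero_of_finite (H := N₁ ⊔ N₂)) hd
  rw [← (N₁ ⊔ N₂).card_mul_index, Nat.factorization_mul Nat.card_pos.ne' index_ne_zero_of_finite,
    Finsupp.add_apply, hb, ha, hp.out.factorization_pow, hp.out.factorization_pow] at hc₂
  simp only [Finsupp.single_eq_same] at hc₂
  omega

theorem MutuallyPermute.isPClosed_top [Finite G] [hp : Fact p.Prime] (h : MutuallyPermute A B)
    (hG : A ⊔ B = ⊤) (hA : IsPClosed p A) (hB : IsPClosed p B)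
    (hr : ∀ r : ℕ, r.Prime → r ∣ Nat.card G → ¬ r ≡ 1 [MOD p])
    (ih : ∀ A' ≤ A, ∀ B' ≤ B, A ⊓ B ≤ A' → A ⊓ B ≤ B' → A' ⊔ B' ≠ ⊤ → IsPClosed p (A' ⊔ B')) :
    IsPClosed p (⊤ : Subgroup G) := by
  have ihB : ∀ T ≤ B, A ⊓ B ≤ T → T ≠ B → IsPClosed p (A ⊔ T) := fun T hT hD hne ↦
    ih A le_rfl T hT inf_le_left hD (h.sup_ne_top hT hD hne)
  have ihA : ∀ T ≤ A, B ⊓ A ≤ T → T ≠ A → IsPClosed p (B ⊔ T) := fun T hT hD hne ↦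
    sup_comm T B ▸ ih T hT B le_rfl (inf_comm B A ▸ hD) inf_le_right
      (sup_comm B T ▸ h.symm.sup_ne_top hT hD hne)
  have hG' : B ⊔ A = ⊤ := sup_comm A B ▸ hG
  by_cases hBA : B ≤ A
  · rwa [← hG, sup_eq_left.2 hBA]
  by_cases hAB : A ≤ B
  · rwa [← hG, sup_eq_right.2 hAB]
  by_cases heB : (A ⊓ B) ⊔ hB.core = B
  · by_cases heA : (B ⊓ A) ⊔ hA.core = A
    · obtain ⟨L₁, hA₁, hi₁, hL₁⟩ := h.exists_isPClosed_index_eq hG hB ihB heB hBA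
      obtain ⟨L₂, hB₂, hi₂, hL₂⟩ := h.symm.exists_isPClosed_index_eq hG' hA ihA heA hAB
      refine hL₁.top_of_index_eq hL₂ hi₁ hi₂ fun g ↦ ?_
      obtain ⟨b, hb, a, ha, e⟩ :=
        (h.right_permutes A le_rfl).mem_sup_iff.1 (hG' ▸ mem_top g : g ∈ B ⊔ A)
      exact ⟨b, hB₂ hb, a, hA₁ ha, e⟩
    · exact h.symm.isPClosed_top_of_core_sup_ne hG' hA hr ihA heA
  · exact h.isPClosed_top_of_core_sup_ne hG hB hr ihB heB

end Step

-- Induction on the group order.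

universe u

open Subgroup in
theorem MutuallyPermute.isPClosed_top_of_card_eq {p : ℕ} [hp : Fact p.Prime] (n : ℕ) :
    ∀ {G : Type u} [Group G] [Finite G] {A B : Subgroup G}, Nat.card G = n →
      MutuallyPermute A B → A ⊔ B = ⊤ → IsPClosed p A → IsPClosed p B →
      (∀ r : ℕ, r.Prime → r ∣ Nat.card G → ¬ r ≡ 1 [MOD p]) → IsPClosed p (⊤ : Subgroup G) := by
  induction n using Nat.strong_induction_on with
  | _ n ih =>
    intro G _ _ A B hn h hG hA hB hr
    refine h.isPClosed_top hG hA hB hr fun A' hA' B' hB' hDA hDB hne ↦ isPClosed_top_iff.1 ?_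
    have hlt : Nat.card (A' ⊔ B' : Subgroup G) < n :=
      hn ▸ lt_of_le_of_ne (card_le_card_group _) fun hc ↦ hne (eq_top_of_card_eq _ hc)
    refine ih _ hlt rfl ((h.mono hA' hB' hDA hDB).subgroupOf le_sup_left le_sup_right) ?_
      ((hA.mono hA').subgroupOf _) ((hB.mono hB').subgroupOf _)
      fun r hrp hrd ↦ hr r hrp (hrd.trans (card_subgroup_dvd_card _))
    rw [← subgroupOf_sup le_sup_left le_sup_right, subgroupOf_self]

/-! ### From extensions to `p`-closure and back. -/

section Extension

open Subgroup

variable {G : Type*} [Group G] [Finite G] {p : ℕ} {π : Set ℕ}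

theorem IsPSpecial.notMem (hπ : IsPSpecial p π) (hp : p.Prime) : p ∉ π :=
  hπ.2 p hp (dvd_mul_right _ _)

theorem IsExtensionPGroupByPiGroup.isPClosed {A : Subgroup G} (hp : p.Prime) (hpπ : p ∉ π)
    (hA : IsExtensionPGroupByPiGroup p π A) : IsPClosed p A := by
  obtain ⟨N, _, hN, hq⟩ := hA
  have := Fact.mk hp
  refine isPClosed_top_iff.1 (.of_normal_of_not_dvd_index (P := N) hN fun hd ↦ ?_)
  exact hpπ (hq p hp hd)

theorem IsExtensionPGroupByPiGroup.eq_or_mem_of_dvd {A : Type*} [Group A] [Finite A]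
    (hp : p.Prime) (hA : IsExtensionPGroupByPiGroup p π A) {r : ℕ} (hr : r.Prime)
    (hd : r ∣ Nat.card A) : r = p ∨ r ∈ π := by
  obtain ⟨N, _, hN, hq⟩ := hA
  have := Fact.mk hp
  rw [← N.card_mul_index, hr.dvd_mul] at hd
  refine hd.imp (fun h ↦ ?_) fun h ↦ hq r hr h
  obtain ⟨n, hn⟩ := IsPGroup.iff_card.1 hN
  exact (Nat.prime_dvd_prime_iff_eq hr hp).1 (hr.dvd_of_dvd_pow (hn ▸ h))

end Extension

theorem mainTheorem7 {G : Type*} [Group G] [Finite G] (p : ℕ) (hp : p.Prime) (π : Set ℕ)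
    (hπ : IsPSpecial p π) (A B : Subgroup G) (hAB : IsMutuallyPermutableProduct A B)
    (hA : IsExtensionPGroupByPiGroup p π A) (hB : IsExtensionPGroupByPiGroup p π B) :
    IsExtensionPGroupByPiGroup p π G := by
  have := Fact.mk hp
  have hpπ := hπ.notMem hp
  have h : MutuallyPermute A B := ⟨hAB.left_permutes, hAB.right_permutes⟩
  have hmul : ∀ g : G, ∃ a ∈ A, ∃ b ∈ B, a * b = g := fun g ↦
    (hAB.mul_eq_univ ▸ Set.mem_univ g : g ∈ (A : Set G) * (B : Set G))
  have hG : A ⊔ B = ⊤ := eq_top_iff.2 fun g _ ↦ by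
    obtain ⟨a, ha, b, hb, rfl⟩ := hmul g
    exact mul_mem (Subgroup.mem_sup_left ha) (Subgroup.mem_sup_right hb)
  have hprime : ∀ r : ℕ, r.Prime → r ∣ Nat.card G → r = p ∨ r ∈ π := by
    intro r hr hd
    rw [← B.card_mul_index, Subgroup.index_eq_relIndex_of_mul hmul, hr.dvd_mul] at hd
    exact hd.elim (hB.eq_or_mem_of_dvd hp hr)
      fun h ↦ hA.eq_or_mem_of_dvd hp hr (h.trans (B.relIndex_dvd_card A))
  have hclosed : IsPClosed p (⊤ : Subgroup G) := by
    refine h.isPClosed_top_of_card_eq _ rfl hG (hA.isPClosed hp hpπ) (hB.isPClosed hp hpπ) ?_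
    intro r hr hd hmod
    have hdvd : p ∣ r - 1 := (Nat.modEq_iff_dvd' hr.one_le).1 hmod.symm
    rcases hprime r hr hd with rfl | hmem
    · have := Nat.le_of_dvd (Nat.sub_pos_of_lt hr.one_lt) hdvd
      have := hr.pos
      omega
    · exact hπ.2 r hr (hdvd.mul_left r) hmem
  refine ⟨hclosed.core, hclosed.core_normal, hclosed.isPGroup_core, fun q hq hd ↦ ?_⟩
  rw [← Subgroup.index_eq_card] at hd
  refine (hprime q hq (hd.trans (Subgroup.index_dvd_card _))).resolve_left ?_
  rintro rfl
  refine hclosed.not_dvd_relIndex_core ?_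
  rwa [Subgroup.relIndex_top_right]
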